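/- Let $G$ be a finite directed graph with vertex set $V$, where multiple edges and loops are allowed. Its adjacency matrix $A_G$ has as $(i,j)$ entry the number of edges from $j$ to $i$, and $G$ is called symmetric if $A_G = A_G^t$. Let $\bowtie$ be a balanced equivalence relation on $V$: any two equivalent vertices receive the same number of edges from each $\bowtie$-class. The quotient graph $Q = G/\bowtie$ has the $\bowtie$-classes as vertices, and the number of its edges from the class $c$ to the class $d$ is the number of edges of $G$ from vertices of $c$ to any one vertex of $d$. Give each cell (vertex) the same phase space $X$, a finite-dimensional Euclidean space. A vector field $F$ on $X^V$ is $G$-admissible if for every $\ell \ge 0$ there is a smooth function $g_\ell : X \times X^\ell \to X$, invariant under all permutations of its last $\ell$ arguments, such that $F_v(x) = g_\ell(x_v; x_{v_1}, \dots, x_{v_\ell})$ for every vertex $v$ of valency (indegree) $\ell$, where $v_1, \dots, v_\ell$ are the sources of the edges directed to $v$, listed with multiplicity. Let $m \ge 0$ be an integer. An admissible gradient function for $G$ is a smooth $f : (\mathbf{R}^m)^V \to \mathbf{R}$ such that the vector field $-\nabla f$ is $G$-admissible (with $X = \mathbf{R}^m$). An admissible Hamiltonian function for $G$ is a smooth $h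 : (\mathbf{R}^{m} \times \mathbf{R}^m)^V \to \mathbf{R}$ of the cell variables $(q_v, p_v)$ such that the Hamiltonian vector field $\dot q_v = \partial h/\partial p_v$, $\dot p_v = -\partial h/\partial q_v$ is $G$-admissible (with $X = \mathbf{R}^m \times \mathbf{R}^m$). The same notions are used for $Q$. Let $\Delta_{\bowtie} = \{x \in X^V : x_u = x_v \text{ whenever } u \bowtie v\}$, which is identified with the phase space $X^{V/\bowtie}$ of $Q$. Proposition. Suppose that $G$ is symmetric and that $Q = G/\bowtie$ is symmetric and connected (in particular non-empty). Then all $\bowtie$-classes have the same cardinality $k \ge 1$, and: (i) for every admissible gradient function $f^G$ for $G$ there is an admissible gradient function $f^Q$ for $Q$, whose gradient system $\dot y = -\nabla f^Q(y)$ is the restriction to $\Delta_{\bowtie}$ of the system $\dot x = -\nabla f^G(x)$, such that $f^G|_{\Delta_{\bowtie}} \equiv k\, f^Q$; (ii) for every admissible Hamiltonian function $h^G$ for $G$ there is an admissible Hamiltonian function $h^Q$ for $Q$, whose Hamiltonian system is the restriction to $\Delta_{\bowtie}$ of the Hamiltonian system of $h^G$, such that $h^G|_{\Delta_{\bowtie}}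 \equiv k\, h^Q$. -/

import Mathlib

open scoped ContDiff Gradient

/-- A directed graph with vertex set `V` and edge set `E`; multiple edges and loops are allowed. -/
structure MultiDigraph (V E : Type*) where
  src : E → V
  tgt : E → V

namespace MultiDigraph

variable {V E : Type*}

/-- The adjacency matrix: the `(i, j)` entry is the number of edges from `j` to `i`. -/
noncomputable def adjMatrix (G : MultiDigraph V E) : Matrix V V ℕ :=
  Matrix.of fun i j => Nat.card {e : E // G.src e = j ∧ G.tgt e = i}

/-- A directed graph is symmetric when there are as many edges from `j` to `i` as from `i` to `j`. -/
def IsSymmetric (G : MultiDigraph V E) : Prop :=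
  G.adjMatrix.IsSymm

/-- Connectedness of the underlying undirected graph (which has to be nonempty). -/
def IsConnected (G : MultiDigraph V E) : Prop :=
  (SimpleGraph.fromRel fun u v => ∃ e, G.src e = u ∧ G.tgt e = v).Connected

/-- The number of edges from vertices in the class `c` to the vertex `v`. -/
noncomputable def numFromClass (G : MultiDigraph V E) (r : Setoid V) (c : Quotient r) (v : V) : ℕ :=
  Nat.card {e : E // (⟦G.src e⟧ : Quotient r) = c ∧ G.tgt e = v}

/-- An equivalence relation is balanced when equivalent vertices receive the same number of edges
from each class. -/
def IsBalanced (G : MultiDigraph V E) (r : Setoid V) : Prop :=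
  ∀ u v, r u v → ∀ c : Quotient r, G.numFromClass r c u = G.numFromClass r c v

/-- The quotient graph: its vertices are the classes, and the edges into a class are the
projections of the edges into one (arbitrarily chosen) vertex of that class. For a balanced
relation, the choice of this vertex does not matter: see `adjMatrix_quotient`. -/
noncomputable def quotient (G : MultiDigraph V E) (r : Setoid V) :
    MultiDigraph (Quotient r) {e : E // G.tgt e = (⟦G.tgt e⟧ : Quotient r).out} where
  src e := ⟦G.src e.1⟧
  tgt e := ⟦G.tgt e.1⟧

theorem adjMatrix_quotient (G : MultiDigraph V E) (r : Setoid V) (hr : G.IsBalanced r)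
    (c : Quotient r) (v : V) :
    (G.quotient r).adjMatrix ⟦v⟧ c = G.numFromClass r c v := by
  have h1 : r (⟦v⟧ : Quotient r).out v := Quotient.mk_out v
  rw [← hr _ _ h1 c]
  refine Nat.card_congr
    { toFun := fun e => ⟨e.1.1, e.2.1, ?_⟩
      invFun := fun e => ⟨⟨e.1, ?_⟩, e.2.1, ?_⟩
      left_inv := fun e => rfl
      right_inv := fun e => rfl }
  · have h2 : (⟦G.tgt e.1.1⟧ : Quotient r) = ⟦v⟧ := e.2.2
    exact e.1.2.trans (congrArg Quotient.out h2)
  · rw [e.2.2, Quotient.out_eq]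
  · change (⟦G.tgt e.1⟧ : Quotient r) = ⟦v⟧
    rw [e.2.2, Quotient.out_eq]

end MultiDigraph

/-- The total phase space `X ^ V` for identical cells with phase space `X` (with the Euclidean
inner product when `X` is Euclidean). -/
abbrev PhaseSpace (V X : Type*) : Type _ := PiLp 2 fun _ : V => X

/-- Admissible vector fields. For each valency `ℓ` there is one smooth function `g ℓ`, invariant
under all permutations of its last `ℓ` arguments, which governs all cells with exactly `ℓ` input
edges: its first argument is the state of the cell, and its other arguments are the states
of the sources of the input edges, listed with multiplicity. -/
def MultiDigraph.IsAdmissible {V E X : Type*} [NormedAddCommGroup X] [NormedSpace ℝ X]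
    (G : MultiDigraph V E) (F : PhaseSpace V X → PhaseSpace V X) : Prop :=
  ∃ g : (ℓ : ℕ) → X × (Fin ℓ → X) → X,
    (∀ ℓ, ContDiff ℝ ∞ (g ℓ)) ∧
    (∀ (ℓ : ℕ) (σ : Equiv.Perm (Fin ℓ)) (a : X) (b : Fin ℓ → X), g ℓ (a, b ∘ σ) = g ℓ (a, b)) ∧
    ∀ (v : V) (ℓ : ℕ) (i : Fin ℓ ≃ {e : E // G.tgt e = v}) (x : PhaseSpace V X),
      F x v = g ℓ (x v, fun j => x (G.src (i j).1))

/-- The polydiagonal subspace of an equivalence relation. -/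
def polydiagonal {V : Type*} (r : Setoid V) (X : Type*) [NormedAddCommGroup X] [NormedSpace ℝ X] :
    Submodule ℝ (PhaseSpace V X) where
  carrier := {x | ∀ u v, r u v → x u = x v}
  add_mem' := by
    intro x y hx hy u v h
    simp [hx u v h, hy u v h]
  zero_mem' := by
    intro u v _
    simp
  smul_mem' := by
    intro a x hx u v h
    simp [hx u v h]

/-- The identification of the phase space of the quotient graph with the polydiagonal subspace:
each cell gets the state of its class. -/
def polydiagonalEquiv {V : Type*} (r : Setoid V) (X : Type*)
    [NormedAddCommGroup X] [NormedSpace ℝ X] :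
    PhaseSpace (Quotient r) X ≃ₗ[ℝ] polydiagonal r X where
  toFun y := ⟨WithLp.toLp 2 fun v => y ⟦v⟧, fun u v h => by
    have h' : (⟦u⟧ : Quotient r) = ⟦v⟧ := Quotient.sound h
    simp [h']⟩
  invFun x := WithLp.toLp 2 fun c => Quotient.lift (fun v => x.1 v) (fun u v h => x.2 u v h) c
  map_add' y z := rfl
  map_smul' a y := rfl
  left_inv y := by
    ext c
    induction c using Quotient.inductionOn
    rfl
  right_inv x := rfl

section Gradient

variable {V X : Type*} [Fintype V] [NormedAddCommGroup X] [InnerProductSpace ℝ X] [CompleteSpace X]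

/-- The vector field of the gradient system `ẋ = -∇ f (x)`. -/
noncomputable def gradientField (f : PhaseSpace V X → ℝ) (x : PhaseSpace V X) : PhaseSpace V X :=
  -∇ f x

/-- Admissible gradient functions for a graph. -/
def MultiDigraph.IsAdmissibleGradientFunction {E : Type*} (G : MultiDigraph V E)
    (f : PhaseSpace V X → ℝ) : Prop :=
  ContDiff ℝ ∞ f ∧ G.IsAdmissible (gradientField f)

/-- The vector field of the Hamiltonian system `q̇ = ∂h/∂p`, `ṗ = -∂h/∂q`, where the state of
the cell `v` is the pair `(q_v, p_v)`. -/
noncomputable def hamiltonianField (h : PhaseSpace V (WithLp 2 (X × X)) → ℝ)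
    (x : PhaseSpace V (WithLp 2 (X × X))) : PhaseSpace V (WithLp 2 (X × X)) :=
  WithLp.toLp 2 fun v => WithLp.toLp 2 ((∇ h x v).snd, -(∇ h x v).fst)

/-- Admissible Hamiltonian functions for a graph. -/
def MultiDigraph.IsAdmissibleHamiltonianFunction {E : Type*} (G : MultiDigraph V E)
    (h : PhaseSpace V (WithLp 2 (X × X)) → ℝ) : Prop :=
  ContDiff ℝ ∞ h ∧ G.IsAdmissible (hamiltonianField h)

end Gradient

/-! ### Class sizes and input sets. -/

namespace MultiDigraph

variable {V E : Type*}

/-! Counting the edges between two classes from either end, with `G` symmetric, gives |d| Q_dc = |c|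
Q_cd. Since Q is symmetric, adjacent classes have equal size, and connectedness spreads this to a
common size k (`IsSymmetric.card_class_eq`).

Let P embed the phase space of Q as the polydiagonal. As all classes have size k, P multiplies inner
products by k (`inner_polydiagonalEquiv`). Admissibility and balance keep ∇f(Py) in the
polydiagonal, so ∇f(Py) = Pw for some w, and the chain rule gives ∇(f ∘ P)(y) = k w. Hence k⁻¹ f ∘ P
has gradient w, and its gradient field is the restricted one. The Hamiltonian field is a fixed
invertible linear map applied to the gradient cell by cell, so the same computation covers it. -/

theorem numFromClass_eq_sum [Fintype V] [Finite E] (G : MultiDigraph V E) (r : Setoid V)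
    [DecidableEq (Quotient r)] (c : Quotient r) (v : V) :
    G.numFromClass r c v = ∑ u with (⟦u⟧ : Quotient r) = c, G.adjMatrix v u := by
  classical
  have := Fintype.ofFinite E
  have hA : ∀ u, G.adjMatrix v u = (Finset.univ.filter fun e => G.src e = u ∧ G.tgt e = v).card :=
    fun u => by
      rw [adjMatrix, Matrix.of_apply, Nat.card_eq_fintype_card, Fintype.card_subtype]
  rw [numFromClass, Nat.card_eq_fintype_card, Fintype.card_subtype,
    Finset.card_eq_sum_card_fiberwise (f := G.src)
      (t := Finset.univ.filter fun u => (⟦u⟧ : Quotient r) = c)]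
  · refine Finset.sum_congr rfl fun u hu => ?_
    rw [hA, Finset.filter_filter]
    congr 1
    ext e
    simp only [Finset.mem_filter, Finset.mem_univ, true_and] at hu ⊢
    constructor
    · rintro ⟨⟨-, h2⟩, h3⟩
      exact ⟨h3, h2⟩
    · rintro ⟨h1, h2⟩
      exact ⟨⟨by rw [h1, hu], h2⟩, h1⟩
  · intro e he
    simp only [Finset.coe_filter, Finset.mem_univ, true_and, Set.mem_ofPred_eq] at he ⊢
    exact he.1

/-- Counting the edges from the class `c` to the class `d` of a symmetric graph in two ways. -/
theorem IsSymmetric.card_mul_adjMatrix_quotient [Fintype V] [Finite E] {G : MultiDigraph V E}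
    (hG : G.IsSymmetric) {r : Setoid V} (hr : G.IsBalanced r) (c d : Quotient r) :
    Nat.card {v : V // (⟦v⟧ : Quotient r) = d} * (G.quotient r).adjMatrix d c =
      Nat.card {v : V // (⟦v⟧ : Quotient r) = c} * (G.quotient r).adjMatrix c d := by
  classical
  have key : ∀ c d : Quotient r,
      Nat.card {v : V // (⟦v⟧ : Quotient r) = d} * (G.quotient r).adjMatrix d c =
        ∑ v with (⟦v⟧ : Quotient r) = d, ∑ u with (⟦u⟧ : Quotient r) = c, G.adjMatrix v u := by
    intro c d
    rw [Nat.card_eq_fintype_card, Fintype.card_subtype, ← smul_eq_mul, ← Finset.sum_const]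
    refine Finset.sum_congr rfl fun v hv => ?_
    rw [← numFromClass_eq_sum, ← adjMatrix_quotient G r hr, (Finset.mem_filter.1 hv).2]
  rw [key, key]
  refine Finset.sum_comm.trans ?_
  exact Finset.sum_congr rfl fun u _ => Finset.sum_congr rfl fun v _ => hG.apply u v

theorem adjMatrix_ne_zero_of_edge [Finite E] (G : MultiDigraph V E) (e : E) :
    G.adjMatrix (G.tgt e) (G.src e) ≠ 0 := by
  have : Nonempty {e' : E // G.src e' = G.src e ∧ G.tgt e' = G.tgt e} := ⟨⟨e, rfl, rfl⟩⟩
  exact Nat.card_pos.ne'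

/-- If a symmetric graph has a symmetric connected quotient, then the classes have the same
cardinality. -/
theorem IsSymmetric.card_class_eq [Fintype V] [Finite E] {G : MultiDigraph V E}
    (hG : G.IsSymmetric) {r : Setoid V} (hr : G.IsBalanced r)
    (hQ : (G.quotient r).IsSymmetric) (hQc : (G.quotient r).IsConnected) (c d : Quotient r) :
    Nat.card {v : V // (⟦v⟧ : Quotient r) = c} = Nat.card {v : V // (⟦v⟧ : Quotient r) = d} := by
  have hedge : ∀ e, Nat.card {v : V // (⟦v⟧ : Quotient r) = (G.quotient r).src e} =
      Nat.card {v : V // (⟦v⟧ : Quotient r) = (G.quotient r).tgt e} := by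
    intro e
    have h := hG.card_mul_adjMatrix_quotient hr ((G.quotient r).src e) ((G.quotient r).tgt e)
    -- Both sides now carry the same entry, which is nonzero because of `e` and can be cancelled.
    rw [hQ.apply ((G.quotient r).tgt e)] at h
    exact (Nat.eq_of_mul_eq_mul_right
      (Nat.pos_of_ne_zero ((G.quotient r).adjMatrix_ne_zero_of_edge e)) h).symm
  obtain ⟨w⟩ := hQc.preconnected c d
  induction w with
  | nil => rfl
  | cons h _ ih =>
    refine Eq.trans ?_ ih
    obtain ⟨-, ⟨e, rfl, rfl⟩ | ⟨e, rfl, rfl⟩⟩ := (SimpleGraph.fromRel_adj _ _ _).1 h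
    · exact hedge e
    · exact (hedge e).symm

/-- For a balanced relation, there is a bijection between the input sets of two equivalent
vertices which preserves the classes of the sources. -/
theorem IsBalanced.exists_inputEquiv [Finite E] {G : MultiDigraph V E} {r : Setoid V}
    (hr : G.IsBalanced r) {u v : V} (huv : r u v) :
    ∃ φ : {e : E // G.tgt e = u} ≃ {e : E // G.tgt e = v},
      ∀ e, r (G.src e.1) (G.src (φ e).1) := by
  let fiber (w : V) (c : Quotient r) : Type _ :=
    {e : {e : E // G.tgt e = w} // (⟦G.src e.1⟧ : Quotient r) = c}
  have hcard : ∀ w c, Nat.card (fiber w c) = G.numFromClass r c w := fun w c =>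
    Nat.card_congr
      { toFun := fun e => ⟨e.1.1, e.2, e.1.2⟩
        invFun := fun e => ⟨⟨e.1, e.2.2⟩, e.2.1⟩
        left_inv := fun _ => rfl
        right_inv := fun _ => rfl }
  have hfin : ∀ w c, Finite (fiber w c) := fun w c => Subtype.finite
  -- Balance makes the fibers over each class equinumerous; arbitrary bijections between them are
  -- then glued.
  let ψ (c : Quotient r) : fiber u c ≃ fiber v c :=
    Classical.choice ((Finite.card_eq).1 (by rw [hcard, hcard, hr u v huv c]))
  let sf (w : V) := Equiv.sigmaFiberEquiv
    (fun e : {e : E // G.tgt e = w} => (⟦G.src e.1⟧ : Quotient r))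
  refine ⟨(sf u).symm.trans ((Equiv.sigmaCongrRight ψ).trans (sf v)), fun e => ?_⟩
  exact Quotient.exact ((ψ ⟦G.src e.1⟧ ⟨e, rfl⟩).2).symm

/-! ### Restriction of admissible vector fields. -/

section Admissible

variable {X : Type*} [NormedAddCommGroup X] [NormedSpace ℝ X]

/-- Polydiagonals of balanced relations are invariant under admissible vector fields. -/
theorem IsAdmissible.mem_polydiagonal [Finite E] {G : MultiDigraph V E} {r : Setoid V}
    (hr : G.IsBalanced r) {F : PhaseSpace V X → PhaseSpace V X} (hF : G.IsAdmissible F)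
    {x : PhaseSpace V X} (hx : x ∈ polydiagonal r X) : F x ∈ polydiagonal r X := by
  obtain ⟨g, -, -, hg⟩ := hF
  intro u v huv
  obtain ⟨φ, hφ⟩ := hr.exists_inputEquiv huv
  let i := (Finite.equivFin {e : E // G.tgt e = u}).symm
  rw [hg u _ i, hg v _ (i.trans φ), hx u v huv]
  congr 2
  funext j
  exact hx _ _ (hφ _)

/-- The restriction of an admissible vector field to a polydiagonal is admissible for the
quotient graph. -/
theorem IsAdmissible.quotient {G : MultiDigraph V E} {r : Setoid V}
    {F : PhaseSpace V X → PhaseSpace V X} (hF : G.IsAdmissible F)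
    {F' : PhaseSpace (Quotient r) X → PhaseSpace (Quotient r) X}
    (h : ∀ y, F (polydiagonalEquiv r X y) = polydiagonalEquiv r X (F' y)) :
    (G.quotient r).IsAdmissible F' := by
  obtain ⟨g, hg1, hg2, hg⟩ := hF
  -- The same `g` works: by construction the input edges of `c` in the quotient are those of `c.out`
  -- in `G`, so the valencies agree.
  refine ⟨g, hg1, hg2, fun c ℓ i y => ?_⟩
  have hP : ∀ (z : PhaseSpace (Quotient r) X) (v : V),
      (polydiagonalEquiv r X z : PhaseSpace V X) v = z ⟦v⟧ := fun _ _ => rfl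
  let φ : {e // (G.quotient r).tgt e = c} ≃ {e : E // G.tgt e = c.out} :=
    { toFun := fun e => ⟨e.1.1, e.1.2.trans (congrArg Quotient.out e.2)⟩
      invFun := fun e => ⟨⟨e.1, by rw [e.2, Quotient.out_eq]⟩, by
        change (⟦G.tgt e.1⟧ : Quotient r) = c
        rw [e.2, Quotient.out_eq]⟩
      left_inv := fun _ => rfl
      right_inv := fun _ => rfl }
  have h1 := hg c.out ℓ (i.trans φ) (polydiagonalEquiv r X y)
  simp only [h, hP, Quotient.out_eq] at h1
  exact h1

end Admissible

end MultiDigraph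

/-! ### Gradients and Hamiltonian fields on the polydiagonal. -/

section Gradient

variable {V X : Type*} [NormedAddCommGroup X] [InnerProductSpace ℝ X] (r : Setoid V)

theorem polydiagonalEquiv_apply (y : PhaseSpace (Quotient r) X) (v : V) :
    (polydiagonalEquiv r X y : PhaseSpace V X) v = y ⟦v⟧ :=
  rfl

/-- The function induced on the phase space of the quotient graph, where `k` is the cardinality of
the classes. -/
noncomputable def quotientFunction (k : ℕ) (f : PhaseSpace V X → ℝ)
    (y : PhaseSpace (Quotient r) X) : ℝ :=
  (k : ℝ)⁻¹ * f (polydiagonalEquiv r X y)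

theorem mul_quotientFunction_symm {k : ℕ} (hk0 : 0 < k) (f : PhaseSpace V X → ℝ)
    (x : polydiagonal r X) :
    f x = k * quotientFunction r k f ((polydiagonalEquiv r X).symm x) := by
  have : (k : ℝ) ≠ 0 := Nat.cast_ne_zero.2 hk0.ne'
  rw [quotientFunction, LinearEquiv.apply_symm_apply, mul_inv_cancel_left₀ this]

variable [Fintype V] [Fintype (Quotient r)]

/-- Each class contributes its term once per member, hence k times. -/
theorem inner_polydiagonalEquiv {k : ℕ}
    (hk : ∀ c : Quotient r, Nat.card {v : V // (⟦v⟧ : Quotient r) = c} = k)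
    (y z : PhaseSpace (Quotient r) X) :
    inner ℝ (polydiagonalEquiv r X y : PhaseSpace V X) (polydiagonalEquiv r X z) =
      k * inner ℝ y z := by
  classical
  simp only [PiLp.inner_apply, polydiagonalEquiv_apply, Finset.mul_sum]
  rw [← Finset.sum_fiberwise (s := Finset.univ) (g := fun v : V => (⟦v⟧ : Quotient r))]
  refine Finset.sum_congr rfl fun c _ => ?_
  rw [← hk c, Nat.card_eq_fintype_card, Fintype.card_subtype, ← nsmul_eq_mul, ← Finset.sum_const]
  exact Finset.sum_congr rfl fun v hv => by rw [(Finset.mem_filter.1 hv).2]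

variable [FiniteDimensional ℝ X]

/-- The embedding of the phase space of the quotient graph as a continuous linear map. -/
noncomputable def polydiagonalCLM (X : Type*) [NormedAddCommGroup X] [InnerProductSpace ℝ X]
    [FiniteDimensional ℝ X] : PhaseSpace (Quotient r) X →L[ℝ] PhaseSpace V X :=
  LinearMap.toContinuousLinearMap
    ((polydiagonal r X).subtype ∘ₗ (polydiagonalEquiv r X).toLinearMap)

theorem contDiff_quotientFunction (k : ℕ) {f : PhaseSpace V X → ℝ} (hf : ContDiff ℝ ∞ f) :
    ContDiff ℝ ∞ (quotientFunction r k f) :=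
  contDiff_const.mul (hf.comp (polydiagonalCLM r X).contDiff)

/-- The assumption `hy` is essential: restricting `f` only determines the orthogonal projection of
its gradient to the polydiagonal. -/
theorem gradient_quotientFunction [CompleteSpace X] {k : ℕ} (hk0 : 0 < k)
    (hk : ∀ c : Quotient r, Nat.card {v : V // (⟦v⟧ : Quotient r) = c} = k)
    {f : PhaseSpace V X → ℝ} (hf : ContDiff ℝ ∞ f) (y : PhaseSpace (Quotient r) X)
    (hy : ∇ f (polydiagonalEquiv r X y) ∈ polydiagonal r X) :
    ∇ f (polydiagonalEquiv r X y) =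
      polydiagonalEquiv r X (∇ (quotientFunction r k f) y) := by
  have hk' : (k : ℝ) ≠ 0 := Nat.cast_ne_zero.2 hk0.ne'
  let w := (polydiagonalEquiv r X).symm ⟨_, hy⟩
  have hw : (polydiagonalEquiv r X w : PhaseSpace V X) = ∇ f (polydiagonalEquiv r X y) := by
    rw [LinearEquiv.apply_symm_apply]
  -- The factor k⁻¹ in `quotientFunction` cancels the k by which the embedding scales inner
  -- products.
  have hgrad : HasGradientAt (quotientFunction r k f) w y := by
    have h1 : HasFDerivAt f _ (polydiagonalCLM r X y) :=
      ((hf.differentiable (by simp)) (polydiagonalCLM r X y)).hasGradientAt.hasFDerivAt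
    have h2 := (h1.comp y (polydiagonalCLM r X).hasFDerivAt).const_mul (k : ℝ)⁻¹
    rw [hasGradientAt_iff_hasFDerivAt]
    refine h2.congr_fderiv ?_
    ext z
    have h3 := inner_polydiagonalEquiv r hk w z
    rw [hw] at h3
    have h4 : (k : ℝ)⁻¹ * inner ℝ (∇ f (polydiagonalEquiv r X y))
        (polydiagonalEquiv r X z : PhaseSpace V X) = inner ℝ w z := by
      rw [h3, inv_mul_cancel_left₀ hk']
    exact h4
  rw [hgrad.gradient, hw]

variable {E : Type*} [Finite E] {G : MultiDigraph V E} {r}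

theorem MultiDigraph.IsAdmissibleGradientFunction.quotient [CompleteSpace X]
    (hr : G.IsBalanced r) {k : ℕ} (hk0 : 0 < k)
    (hk : ∀ c : Quotient r, Nat.card {v : V // (⟦v⟧ : Quotient r) = c} = k)
    {f : PhaseSpace V X → ℝ} (hf : G.IsAdmissibleGradientFunction f) :
    (G.quotient r).IsAdmissibleGradientFunction (quotientFunction r k f) ∧
      ∀ y, gradientField f (polydiagonalEquiv r X y) =
        polydiagonalEquiv r X (gradientField (quotientFunction r k f) y) := by
  have hfield : ∀ y, gradientField f (polydiagonalEquiv r X y) =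
      polydiagonalEquiv r X (gradientField (quotientFunction r k f) y) := by
    intro y
    have hmem := hf.2.mem_polydiagonal hr (polydiagonalEquiv r X y).2
    have h := gradient_quotientFunction r hk0 hk hf.1 y (neg_mem_iff.1 hmem)
    simp only [gradientField, map_neg, Submodule.coe_neg, h]
  exact ⟨⟨contDiff_quotientFunction r k hf.1, hf.2.quotient hfield⟩, hfield⟩

theorem MultiDigraph.IsAdmissibleHamiltonianFunction.quotient [CompleteSpace X]
    (hr : G.IsBalanced r) {k : ℕ} (hk0 : 0 < k)
    (hk : ∀ c : Quotient r, Nat.card {v : V // (⟦v⟧ : Quotient r) = c} = k)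
    {h : PhaseSpace V (WithLp 2 (X × X)) → ℝ} (hh : G.IsAdmissibleHamiltonianFunction h) :
    (G.quotient r).IsAdmissibleHamiltonianFunction (quotientFunction r k h) ∧
      ∀ y, hamiltonianField h (polydiagonalEquiv r (WithLp 2 (X × X)) y) =
        polydiagonalEquiv r (WithLp 2 (X × X)) (hamiltonianField (quotientFunction r k h) y) := by
  have hfield : ∀ y, hamiltonianField h (polydiagonalEquiv r (WithLp 2 (X × X)) y) =
      polydiagonalEquiv r (WithLp 2 (X × X)) (hamiltonianField (quotientFunction r k h) y) := by
    intro y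
    have hmem : ∇ h (polydiagonalEquiv r (WithLp 2 (X × X)) y) ∈
        polydiagonal r (WithLp 2 (X × X)) := by
      intro u v huv
      have huv' := hh.2.mem_polydiagonal hr (polydiagonalEquiv r (WithLp 2 (X × X)) y).2 u v huv
      have h1 := congrArg WithLp.fst huv'
      have h2 := congrArg WithLp.snd huv'
      -- The field swaps the two gradient components up to sign, so its equality at `u` and `v`
      -- gives that of the gradient.
      exact WithLp.ofLp_injective 2 (Prod.ext (neg_injective h2) h1)
    have hgrad := gradient_quotientFunction r hk0 hk hh.1 y hmem
    ext1 v
    simp only [hamiltonianField, hgrad, polydiagonalEquiv_apply]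
  exact ⟨⟨contDiff_quotientFunction r k hh.1, hh.2.quotient hfield⟩, hfield⟩

end Gradient

theorem mainTheorem6 {V E : Type*} [Fintype V] [Finite E] (G : MultiDigraph V E)
    (r : Setoid V) [Fintype (Quotient r)] (hG : G.IsSymmetric) (hr : G.IsBalanced r)
    (hQ : (G.quotient r).IsSymmetric) (hQc : (G.quotient r).IsConnected) (m : ℕ) :
    ∃ k : ℕ, 0 < k ∧ (∀ c : Quotient r, Nat.card {v : V // (⟦v⟧ : Quotient r) = c} = k) ∧
      (∀ fG : PhaseSpace V (EuclideanSpace ℝ (Fin m)) → ℝ, G.IsAdmissibleGradientFunction fG →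
        ∃ fQ : PhaseSpace (Quotient r) (EuclideanSpace ℝ (Fin m)) → ℝ,
          (G.quotient r).IsAdmissibleGradientFunction fQ ∧
          (∀ y, gradientField fG (polydiagonalEquiv r _ y) =
            polydiagonalEquiv r _ (gradientField fQ y)) ∧
          ∀ x : polydiagonal r (EuclideanSpace ℝ (Fin m)),
            fG x = k * fQ ((polydiagonalEquiv r _).symm x)) ∧
      (∀ hamG : PhaseSpace V
            (WithLp 2 (EuclideanSpace ℝ (Fin m) × EuclideanSpace ℝ (Fin m))) → ℝ,
          G.IsAdmissibleHamiltonianFunction hamG →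
        ∃ hamQ : PhaseSpace (Quotient r)
            (WithLp 2 (EuclideanSpace ℝ (Fin m) × EuclideanSpace ℝ (Fin m))) → ℝ,
          (G.quotient r).IsAdmissibleHamiltonianFunction hamQ ∧
          (∀ y, hamiltonianField hamG (polydiagonalEquiv r _ y) =
            polydiagonalEquiv r _ (hamiltonianField hamQ y)) ∧
          ∀ x : polydiagonal r
              (WithLp 2 (EuclideanSpace ℝ (Fin m) × EuclideanSpace ℝ (Fin m))),
            hamG x = k * hamQ ((polydiagonalEquiv r _).symm x)) := by
  obtain ⟨c₀⟩ := hQc.nonempty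
  have hk := fun c => hG.card_class_eq hr hQ hQc c c₀
  have : Nonempty {v : V // (⟦v⟧ : Quotient r) = c₀} := ⟨⟨c₀.out, c₀.out_eq⟩⟩
  have hk0 : 0 < Nat.card {v : V // (⟦v⟧ : Quotient r) = c₀} := Nat.card_pos
  refine ⟨_, hk0, hk, fun fG hf => ?_, fun hamG hh => ?_⟩
  · obtain ⟨h1, h2⟩ := hf.quotient hr hk0 hk
    exact ⟨_, h1, h2, mul_quotientFunction_symm r hk0 fG⟩
  · obtain ⟨h1, h2⟩ := hh.quotient hr hk0 hk
    exact ⟨_, h1, h2, mul_quotientFunction_symm r hk0 hamG⟩
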